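/- Let $p$ be an odd prime, let $m$ be a positive integer with $m\equiv 2 \pmod 4$, and let $q=p^m$. Let $\mathrm{Tr}$ be the trace function from $\mathrm{GF}(q)$ onto $\mathrm{GF}(p)$, let $$D=\{x\in \mathrm{GF}(q)^* : \mathrm{Tr}(x^{p+1}-x)=0\}=\{d_1,\ldots,d_n\},\qquad n=|D|,$$ and let $$\mathcal{C}_D=\{(\mathrm{Tr}(xd_1),\ldots,\mathrm{Tr}(xd_n)) : x\in \mathrm{GF}(q)\}\subseteq \mathrm{GF}(p)^n .$$ Write $A_w$ for the number of codewords of Hamming weight $w$ in $\mathcal{C}_D$. Then $\mathcal{C}_D$ is an $[n,m]$ linear code over $\mathrm{GF}(p)$ (that is, an $m$-dimensional subspace of $\mathrm{GF}(p)^n$) of length $$n=\begin{cases} p^{m-1}-1-(p-1)p^{\frac12(m-1+(-1)^{m/2})} & \text{if } p\mid m,\\ p^{m-1}-1+p^{\frac12(m-1+(-1)^{m/2})} & \text{if } p\nmid m.\end{cases}$$ It has at most three nonzero weights, that is, $A_w\neq 0$ for at most three $w\in\{1,\ldots,n\}$, and it has exactly two nonzero weights if and only if $m=2$. Its weight distribution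 is as follows, where $A_w=0$ for every $w$ that is not listed. If $p\mid m$: - $A_0=1$; - $A_w=p^{m-2}-(p-1)p^{\frac m2-1}-1$ for $w=(p-1)p^{m-2}$; - $A_w=(p-1)\bigl(2p^{m-2}+p^{\frac m2-1}\bigr)$ for $w=(p-1)\bigl(p^{m-2}-p^{\frac m2-1}\bigr)$; - $A_w=(p-1)^2p^{m-2}$ for $w=(p-1)p^{m-2}-(p-2)p^{\frac m2-1}$. If $p\nmid m$: - $A_0=1$; - $A_w=p^{m-2}+\frac{p-1}{2}\bigl(p^{m-1}+p^{\frac m2}\bigr)-1$ for $w=(p-1)p^{m-2}$; - $A_w=(p-1)\bigl(2p^{m-2}-p^{\frac m2-1}\bigr)$ for $w=(p-1)p^{m-2}+p^{\frac m2-1}$; - $A_w=\frac{(p-1)(p-2)}{2}\bigl(p^{m-2}-p^{\frac m2-1}\bigr)$ for $w=(p-1)p^{m-2}+2p^{\frac m2-1}$. -/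

import Mathlib

section TraceCodes

variable (p : ℕ) (F : Type*) [Field F] [Algebra (ZMod p) F]

/-- The defining set `D = {x ∈ GF(q)^* : Tr(x^(p+1) - x) = 0}`, where `F = GF(q)` and `Tr` is the
trace from `GF(q)` onto `GF(p)`. -/
def definingSet : Set F :=
  {x | x ≠ 0 ∧ Algebra.trace (ZMod p) F (x ^ (p + 1) - x) = 0}

variable {F}

/-- The code of length `n` over `GF(p)` attached to a list `d_1, …, d_n` of elements of `GF(q)`:
all words `(Tr(x d_1), …, Tr(x d_n))` for `x ∈ GF(q)`. -/
def traceCode {n : ℕ} (d : Fin n → F) : Submodule (ZMod p) (Fin n → ZMod p) where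
  carrier := {c | ∃ x : F, c = fun i => Algebra.trace (ZMod p) F (x * d i)}
  zero_mem' := ⟨0, by ext i; simp⟩
  add_mem' := by
    rintro _ _ ⟨x, rfl⟩ ⟨y, rfl⟩
    exact ⟨x + y, by ext i; simp [add_mul]⟩
  smul_mem' := by
    rintro a _ ⟨x, rfl⟩
    exact ⟨a • x, by ext i; simp⟩

variable {p}

/-- `A_w`: the number of codewords of Hamming weight `w` in a linear code. -/
noncomputable def weightCount {n : ℕ} (C : Submodule (ZMod p) (Fin n → ZMod p)) (w : ℕ) : ℕ :=
  Set.ncard {c : Fin n → ZMod p | c ∈ C ∧ hammingNorm c = w}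

/-- The number of `i ∈ {1, …, n}` with `A_i ≠ 0`; a code of length `n` is a `t`-weight code if
this number is `t`. -/
noncomputable def numNonzeroWeights {n : ℕ} (C : Submodule (ZMod p) (Fin n → ZMod p)) : ℕ :=
  Set.ncard {i : ℕ | 1 ≤ i ∧ i ≤ n ∧ weightCount C i ≠ 0}

end TraceCodes

/-!
The code is governed by the quadratic form `Q(x) = Tr(x ^ (p + 1))` on `F = GF(p ^ m)`, where
`m = 2 (j + 1)` with `j` even.

* `Q` is nondegenerate (`separatingLeft_traceNormForm`): a vector of the radical satisfies
  `x ^ (p ^ 2) = -x`, and iterating this `m / 2` times, an odd number, gives `x = -x`.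
* Every `y ≠ 0` in the prime field is `u ^ (p + 1)` for some `u`, so `x ↦ u x` is a similitude of
  ratio `y` and the exponential sum `S = ∑ ψ(y Q(x))` does not depend on `y`
  (`quadraticSum_traceNormForm`). Hence `S ^ 2 = p ^ m` (`sq_eq_card_of_quadraticSum_eq`). The
  `(p + 1)`-st roots of unity act freely on `{Q = 1}`, and reducing the order of this set modulo
  `p + 1` leaves only `S = -p ^ (m / 2)` (`isElliptic_traceNormForm`). No Gauss sums are evaluated.
* Put `v = -1/2`, so that `Q(x) - Tr(x) = Q(v + x) - Q(v)`. This gives the length, as `Q(v) = m / 4`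
  vanishes exactly when `p ∣ m`. By nondegeneracy each `b` has the form `Tr(b x) = polar Q g x` for a
  unique `g`, and completing the square in the double character sum shows that the weight of the
  codeword of `b ≠ 0` is an affine function of the number `T(g)` of `t ∈ GF(p)` with
  `Q(v + t g) = 0` (`IsElliptic.card_section`, `hammingNorm_traceWord_dual`).
* `T(g)` is the number of roots of a polynomial of degree at most two in `t`, so it takes at most
  three values. If `Q(v) = 0` it depends only on which of `Q(g)` and `polar Q v g` vanish, and these
  conditions are counted directly. If `Q(v) ≠ 0`, the vectors `g` with `T(g) = 1` are counted by
  means of the tangent cone (`IsElliptic.card_tangent_cone`), and the mean value of `T`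
  (`IsElliptic.sum_lineCount`) then gives the other two frequencies, without a distinction between
  square and nonsquare discriminants.
-/

open QuadraticMap (polar polar_add_left polar_smul_left)

/-! ### Character sums of quadratic forms -/

section CharacterSums

variable {p : ℕ} [Fact p.Prime]

/-- Orthogonality: summing the standard character over all multiples of `a` detects `a = 0`. -/
theorem sum_stdAddChar_mul (a : ZMod p) :
    ∑ y : ZMod p, ZMod.stdAddChar (y * a) = if a = 0 then (p : ℂ) else 0 := by
  have h := AddChar.sum_mulShift a (ZMod.isPrimitive_stdAddChar p)
  rw [h]
  split_ifs <;> simp [ZMod.card]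

theorem sum_ne_zero_stdAddChar_mul (a : ZMod p) :
    ∑ y : ZMod p with y ≠ 0, ZMod.stdAddChar (y * a) = (if a = 0 then (p : ℂ) else 0) - 1 := by
  have h := Finset.sum_filter_add_sum_filter_not (Finset.univ : Finset (ZMod p)) (fun y => y ≠ 0)
    (fun y => (ZMod.stdAddChar (y * a) : ℂ))
  rw [sum_stdAddChar_mul] at h
  rw [← h]
  simp [Finset.filter_eq']

theorem card_zero_eq_sum {V : Type*} [Fintype V] (f : V → ZMod p) :
    (p : ℂ) * (Finset.univ.filter fun x => f x = 0).card =
      ∑ y : ZMod p, ∑ x : V, ZMod.stdAddChar (y * f x) := by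
  rw [Finset.sum_comm]
  simp_rw [sum_stdAddChar_mul]
  rw [← Finset.sum_filter, Finset.sum_const, nsmul_eq_mul, mul_comm]

theorem card_zero_zero_eq_sum {V : Type*} [Fintype V] (f g : V → ZMod p) :
    (p : ℂ) ^ 2 * (Finset.univ.filter fun x => f x = 0 ∧ g x = 0).card =
      ∑ y : ZMod p, ∑ z : ZMod p, ∑ x : V, ZMod.stdAddChar (y * f x + z * g x) := by
  have : ∀ y : ZMod p, ∑ z : ZMod p, ∑ x : V, (ZMod.stdAddChar (y * f x + z * g x) : ℂ) =
      ∑ x : V, ZMod.stdAddChar (y * f x) * (if g x = 0 then (p : ℂ) else 0) := by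
    intro y
    rw [Finset.sum_comm]
    simp_rw [AddChar.map_add_eq_mul, ← Finset.mul_sum, sum_stdAddChar_mul]
  simp_rw [this]
  rw [Finset.sum_comm]
  simp_rw [← Finset.sum_mul, sum_stdAddChar_mul, ite_zero_mul_ite_zero]
  rw [← Finset.sum_filter, Finset.sum_const, nsmul_eq_mul, mul_comm, sq]

end CharacterSums

section QuadraticForms

variable {p : ℕ} [Fact p.Prime] {V : Type*} [AddCommGroup V] [Module (ZMod p) V] [Fintype V]

/-- The exponential sum `∑ ψ(y Q(x))` over `V`, for the standard additive character `ψ` of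
`ZMod p`. -/
noncomputable def quadraticSum (Q : QuadraticForm (ZMod p) V) (y : ZMod p) : ℂ :=
  ∑ x : V, ZMod.stdAddChar (y * Q x)

/-- The number of parameters `t` at which the affine line `v + t g` meets the quadric `Q = 0`. -/
def lineCount (Q : QuadraticForm (ZMod p) V) (v g : V) : ℕ :=
  (Finset.univ.filter fun t : ZMod p => Q (v + t • g) = 0).card

variable {Q : QuadraticForm (ZMod p) V}

theorem sum_stdAddChar_polar [DecidableEq V] (hQ : Q.polarBilin.SeparatingLeft) (g : V) :
    ∑ x : V, (ZMod.stdAddChar (polar Q g x) : ℂ) = if g = 0 then (Fintype.card V : ℂ) else 0 := by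
  classical
  by_cases hg : g = 0
  · simp [hg]
  · rw [if_neg hg]
    have h := AddChar.sum_eq_ite
      ((ZMod.stdAddChar (N := p)).compAddMonoidHom (Q.polarBilin g).toAddMonoidHom)
    simp only [AddChar.compAddMonoidHom_apply, LinearMap.toAddMonoidHom_coe,
      QuadraticMap.polarBilin_apply_apply] at h
    rw [h, if_neg]
    intro h0
    apply hg
    apply hQ
    intro x
    -- an element killed by all of `ψ(t ·)` is zero, as `ψ` is primitive
    by_contra hx
    rw [QuadraticMap.polarBilin_apply_apply] at hx
    have h1 := sum_stdAddChar_mul (polar Q g x)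
    rw [if_neg hx] at h1
    have h2 : ∀ t : ZMod p, (ZMod.stdAddChar (t * polar Q g x) : ℂ) = 1 := by
      intro t
      have := DFunLike.congr_fun h0 (t • x)
      simpa using this
    simp [h2, NeZero.ne p] at h1

/-- Completing the square: a linear term of the form `polar Q v` is absorbed by the translation
by `v`. -/
theorem sum_stdAddChar_add_polar (v : V) (y : ZMod p) :
    ∑ x : V, (ZMod.stdAddChar (y * (Q x + polar Q v x)) : ℂ) =
      quadraticSum Q y * ZMod.stdAddChar (y * -Q v) := by
  rw [quadraticSum, ← Equiv.sum_comp (Equiv.addLeft v) (fun x => ZMod.stdAddChar (y * Q x)),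
    Finset.sum_mul]
  refine Finset.sum_congr rfl fun x _ => ?_
  rw [← AddChar.map_add_eq_mul]
  congr 1
  simp only [Equiv.coe_addLeft, QuadraticMap.map_add Q]
  ring

theorem quadraticSum_zero : quadraticSum Q 0 = Fintype.card V := by simp [quadraticSum]

/-- If the exponential sum does not depend on the nonzero parameter, its square is the order of
the space. -/
theorem sq_eq_card_of_quadraticSum_eq (hQ : Q.polarBilin.SeparatingLeft) {S : ℂ}
    (hS : ∀ y ≠ 0, quadraticSum Q y = S) : S ^ 2 = Fintype.card V := by
  have h1 := hS 1 one_ne_zero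
  have h2 := hS (-1) (neg_ne_zero.2 one_ne_zero)
  -- `S ^ 2` is the product of the sums for `1` and `-1`, so no complex conjugation is needed
  have h3 : ∀ z : V, ∑ x : V, (ZMod.stdAddChar (1 * Q x) : ℂ) * ZMod.stdAddChar (-1 * Q z) =
      ∑ h : V, (ZMod.stdAddChar (Q h) : ℂ) * ZMod.stdAddChar (polar Q h z) := by
    intro z
    rw [← Equiv.sum_comp (Equiv.addRight z)]
    refine Finset.sum_congr rfl fun x _ => ?_
    rw [← AddChar.map_add_eq_mul, ← AddChar.map_add_eq_mul]
    congr 1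
    simp only [Equiv.coe_addRight, QuadraticMap.map_add Q]
    ring
  calc S ^ 2 = quadraticSum Q 1 * quadraticSum Q (-1) := by rw [h1, h2, sq]
    _ = ∑ z : V, ∑ x : V, (ZMod.stdAddChar (1 * Q x) : ℂ) * ZMod.stdAddChar (-1 * Q z) := by
      rw [quadraticSum, quadraticSum, Finset.sum_mul_sum, Finset.sum_comm]
    _ = ∑ h : V, (ZMod.stdAddChar (Q h) : ℂ) * ∑ z : V, ZMod.stdAddChar (polar Q h z) := by
      simp_rw [h3, Finset.mul_sum]
      rw [Finset.sum_comm]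
    _ = Fintype.card V := by
      classical
      simp_rw [sum_stdAddChar_polar hQ]
      simp

/-- The number of points of the quadric `Q = c`. -/
theorem card_quadric {S : ℂ} (hS : ∀ y ≠ 0, quadraticSum Q y = S) (c : ZMod p) :
    (p : ℂ) * (Finset.univ.filter fun x => Q x = c).card =
      Fintype.card V + S * ((if c = 0 then (p : ℂ) else 0) - 1) := by
  have h := card_zero_eq_sum (fun x : V => Q x - c)
  simp only [sub_eq_zero] at h
  rw [h]
  have h1 : ∀ y : ZMod p, ∑ x : V, (ZMod.stdAddChar (y * (Q x - c)) : ℂ) =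
      quadraticSum Q y * ZMod.stdAddChar (y * -c) := by
    intro y
    rw [quadraticSum, Finset.sum_mul]
    refine Finset.sum_congr rfl fun x _ => ?_
    rw [← AddChar.map_add_eq_mul]
    congr 1
    ring
  simp_rw [h1]
  rw [← Finset.sum_filter_add_sum_filter_not Finset.univ (fun y : ZMod p => y ≠ 0), add_comm]
  congr 1
  · simp [Finset.filter_eq', quadraticSum_zero]
  · have h2 := sum_ne_zero_stdAddChar_mul (-c)
    simp only [neg_eq_zero] at h2
    rw [← h2, Finset.mul_sum]
    refine Finset.sum_congr rfl fun y hy => ?_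
    rw [hS y (Finset.mem_filter.1 hy).2]

/-- The number of points of the quadric `Q + polar Q v = 0` on the hyperplane orthogonal to `g`
is governed by the intersection of the line `v + t g` with `Q = 0`. -/
theorem card_quadric_hyperplane (hQ : Q.polarBilin.SeparatingLeft) {S : ℂ}
    (hS : ∀ y ≠ 0, quadraticSum Q y = S) (v : V) {g : V} (hg : g ≠ 0) :
    (p : ℂ) ^ 2 * (Finset.univ.filter fun x => Q x + polar Q v x = 0 ∧ polar Q g x = 0).card =
      Fintype.card V + S * (p * (lineCount Q v g - 1)) := by
  rw [card_zero_zero_eq_sum, ← Finset.sum_filter_add_sum_filter_not Finset.univ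
    (fun y : ZMod p => y ≠ 0), add_comm]
  congr 1
  · simp only [not_not, Finset.filter_eq', Finset.mem_univ, if_true, Finset.sum_singleton, zero_mul,
      zero_add]
    have h1 : ∀ z : ZMod p, ∑ x : V, (ZMod.stdAddChar (z * polar Q g x) : ℂ) =
        if z = 0 then (Fintype.card V : ℂ) else 0 := by
      classical
      intro z
      have h2 := sum_stdAddChar_polar hQ (z • g)
      simp only [polar_smul_left, smul_eq_mul, smul_eq_zero, hg, or_false] at h2
      exact h2
    simp_rw [h1]
    simp
  -- for `y ≠ 0` substitute `z = y t` and absorb the linear term `polar Q (v + t g)`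
  · have h1 : ∀ y : ZMod p, y ≠ 0 →
        ∑ z : ZMod p, ∑ x : V,
          (ZMod.stdAddChar (y * (Q x + polar Q v x) + z * polar Q g x) : ℂ) =
        ∑ t : ZMod p, S * ZMod.stdAddChar (y * -Q (v + t • g)) := by
      intro y hy
      rw [← Equiv.sum_comp (Equiv.mulLeft₀ y hy)]
      refine Finset.sum_congr rfl fun t _ => ?_
      rw [← hS y hy, ← sum_stdAddChar_add_polar]
      refine Finset.sum_congr rfl fun x _ => ?_
      congr 1
      simp only [Equiv.mulLeft₀_apply, polar_add_left, polar_smul_left, smul_eq_mul]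
      ring
    rw [Finset.sum_congr rfl fun y hy => h1 y (Finset.mem_filter.1 hy).2, Finset.sum_comm]
    simp_rw [← Finset.mul_sum, sum_ne_zero_stdAddChar_mul, neg_eq_zero]
    rw [Finset.sum_sub_distrib, ← Finset.sum_filter, Finset.sum_const, nsmul_eq_mul, lineCount]
    simp only [Finset.sum_const, Finset.card_univ, ZMod.card, nsmul_eq_mul, mul_one]
    ring

/-- A translate of the quadric `Q + polar Q v = 0` is a level set of `Q`. -/
theorem card_quadric_translate (v : V) :
    (Finset.univ.filter fun x => Q x + polar Q v x = 0).card =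
      (Finset.univ.filter fun x => Q x = Q v).card := by
  refine Finset.card_bij' (fun x _ => v + x) (fun x _ => x - v) ?_ ?_ ?_ ?_
  · intro x hx
    simp only [Finset.mem_filter, Finset.mem_univ, true_and] at hx ⊢
    rw [QuadraticMap.map_add Q, add_assoc, hx, add_zero]
  · intro x hx
    simp only [Finset.mem_filter, Finset.mem_univ, true_and] at hx ⊢
    have h := QuadraticMap.map_add Q v (x - v)
    rw [add_sub_cancel, hx, add_assoc] at h
    simpa using h
  · intro x _
    simp
  · intro x _
    simp

end QuadraticForms

/-! ### Roots of quadratic polynomials and lines meeting a quadric -/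

section QuadraticEquations

variable {p : ℕ} [Fact p.Prime]

/-- The number of roots in `ZMod p` of `a t² + b t + c`. -/
def rootCount (a b c : ZMod p) : ℕ :=
  (Finset.univ.filter fun t : ZMod p => a * (t * t) + b * t + c = 0).card

theorem rootCount_zero_zero (c : ZMod p) : rootCount 0 0 c = if c = 0 then p else 0 := by
  by_cases hc : c = 0 <;> simp [rootCount, hc, ZMod.card]

theorem rootCount_of_linear {b : ZMod p} (hb : b ≠ 0) (c : ZMod p) : rootCount 0 b c = 1 := by
  rw [rootCount, Finset.card_eq_one]
  refine ⟨-c / b, ?_⟩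
  ext t
  simp only [Finset.mem_filter, Finset.mem_univ, true_and, Finset.mem_singleton]
  rw [eq_div_iff hb]
  constructor <;> intro h <;> linear_combination h

theorem rootCount_of_discrim_eq_zero (hp : (2 : ZMod p) ≠ 0) {a b c : ZMod p} (ha : a ≠ 0)
    (h : discrim a b c = 0) : rootCount a b c = 1 := by
  have : NeZero (2 : ZMod p) := ⟨hp⟩
  rw [rootCount, Finset.card_eq_one]
  refine ⟨-b / (2 * a), ?_⟩
  ext t
  simp [quadratic_eq_zero_iff_of_discrim_eq_zero ha h]

theorem rootCount_of_discrim_eq_sq (hp : (2 : ZMod p) ≠ 0) {a b c s : ZMod p} (ha : a ≠ 0)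
    (hs : s ≠ 0) (h : discrim a b c = s * s) : rootCount a b c = 2 := by
  have : NeZero (2 : ZMod p) := ⟨hp⟩
  rw [rootCount, Finset.card_eq_two]
  refine ⟨(-b + s) / (2 * a), (-b - s) / (2 * a), ?_, ?_⟩
  · intro h1
    rw [div_left_inj' (mul_ne_zero hp ha)] at h1
    have : 2 * s = 0 := by linear_combination h1
    simp_all
  · ext t
    simp [quadratic_eq_zero_iff ha h]

theorem rootCount_of_discrim_ne_zero (hp : (2 : ZMod p) ≠ 0) {a b c : ZMod p} (ha : a ≠ 0)
    (h : discrim a b c ≠ 0) : rootCount a b c = 0 ∨ rootCount a b c = 2 := by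
  by_cases hs : ∃ s, discrim a b c = s * s
  · obtain ⟨s, hs⟩ := hs
    refine Or.inr (rootCount_of_discrim_eq_sq hp ha ?_ hs)
    rintro rfl
    simp_all
  · left
    rw [rootCount, Finset.card_eq_zero, Finset.filter_eq_empty_iff]
    intro t _
    refine quadratic_ne_zero_of_discrim_ne_sq (fun s h1 => hs ⟨s, ?_⟩) t
    rw [h1, sq]

/-- The root count when the constant term vanishes. -/
theorem rootCount_const_zero (hp : (2 : ZMod p) ≠ 0) (a b : ZMod p) :
    rootCount a b 0 = if a = 0 ∧ b = 0 then p else if a ≠ 0 ∧ b ≠ 0 then 2 else 1 := by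
  by_cases ha : a = 0
  · by_cases hb : b = 0
    · simp [ha, hb, rootCount_zero_zero]
    · simp [ha, hb, rootCount_of_linear hb]
  · by_cases hb : b = 0
    · simp only [ha, hb, false_and, if_false, ne_eq, not_true, and_false]
      exact rootCount_of_discrim_eq_zero hp ha (by simp [discrim])
    · simp only [ha, hb, if_false, ne_eq, not_false_eq_true, and_self, if_true]
      exact rootCount_of_discrim_eq_sq hp ha hb (by simp [discrim, sq])

/-- The root count when the constant term does not vanish. -/
theorem rootCount_const_ne_zero (hp : (2 : ZMod p) ≠ 0) {c : ZMod p} (hc : c ≠ 0) (a b : ZMod p) :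
    (rootCount a b c = 0 ∨ rootCount a b c = 1 ∨ rootCount a b c = 2) ∧
    (rootCount a b c = 1 ↔ (a = 0 ∧ b ≠ 0) ∨ (a ≠ 0 ∧ b ^ 2 - 4 * a * c = 0)) := by
  by_cases ha : a = 0
  · by_cases hb : b = 0
    · simp [ha, hb, rootCount_zero_zero, hc]
    · simp [ha, hb, rootCount_of_linear hb]
  · by_cases hd : discrim a b c = 0
    · have := rootCount_of_discrim_eq_zero hp ha hd
      rw [discrim] at hd
      simp [this, ha, hd]
    · have := rootCount_of_discrim_ne_zero hp ha hd
      rw [discrim] at hd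
      rcases this with h | h <;> simp [h, ha, hd]

theorem prime_ne_two_of_two_ne_zero (hp : (2 : ZMod p) ≠ 0) : p ≠ 2 := by
  rintro rfl
  exact hp rfl

end QuadraticEquations

section LineCounts

variable {p : ℕ} [Fact p.Prime] {V : Type*} [AddCommGroup V] [Module (ZMod p) V]
  {Q : QuadraticForm (ZMod p) V}

theorem lineCount_eq_rootCount (v g : V) :
    lineCount Q v g = rootCount (Q g) (polar Q v g) (Q v) := by
  rw [lineCount, rootCount]
  congr 1
  ext t
  have h : Q (v + t • g) = Q g * (t * t) + polar Q v g * t + Q v := by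
    rw [QuadraticMap.map_add Q, QuadraticMap.map_smul, QuadraticMap.polar_smul_right]
    simp only [smul_eq_mul]
    ring
  simp [h]

theorem lineCount_of_isotropic (hp : (2 : ZMod p) ≠ 0) {v : V} (hv : Q v = 0) (g : V) :
    lineCount Q v g =
      if Q g = 0 ∧ polar Q v g = 0 then p else if Q g ≠ 0 ∧ polar Q v g ≠ 0 then 2 else 1 := by
  rw [lineCount_eq_rootCount, hv, rootCount_const_zero hp]

theorem lineCount_of_anisotropic (hp : (2 : ZMod p) ≠ 0) {v : V} (hv : Q v ≠ 0) (g : V) :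
    (lineCount Q v g = 0 ∨ lineCount Q v g = 1 ∨ lineCount Q v g = 2) ∧
    (lineCount Q v g = 1 ↔ (Q g = 0 ∧ polar Q v g ≠ 0) ∨
      (Q g ≠ 0 ∧ polar Q v g ^ 2 - 4 * Q g * Q v = 0)) := by
  rw [lineCount_eq_rootCount]
  exact rootCount_const_ne_zero hp hv _ _

theorem lineCount_zero_right {v : V} (hv : Q v ≠ 0) : lineCount Q v 0 = 0 := by
  simp [lineCount, hv]

end LineCounts

/-! ### Counting points for forms of minus type -/

section EllipticForms

variable {p : ℕ} [Fact p.Prime] {V : Type*} [AddCommGroup V] [Module (ZMod p) V] [Fintype V]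

/-- A nondegenerate quadratic form in `2 (j + 1)` variables over `ZMod p` of minus (elliptic) type.
The type is encoded by the value `-p ^ (j + 1)` of all its nontrivial exponential sums. -/
structure IsElliptic (Q : QuadraticForm (ZMod p) V) (j : ℕ) : Prop where
  separatingLeft : Q.polarBilin.SeparatingLeft
  card_eq : Fintype.card V = p ^ (2 * j + 2)
  sum_eq : ∀ y ≠ 0, quadraticSum Q y = -(p : ℂ) ^ (j + 1)

variable {Q : QuadraticForm (ZMod p) V} {j : ℕ}

/-- The number of nonzero directions `g` in which the line through `v` meets the quadric `Q = 0`
in exactly `t` points. -/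
def directionCount [DecidableEq V] (Q : QuadraticForm (ZMod p) V) (v : V) (t : ℕ) : ℕ :=
  (Finset.univ.filter fun g : V => g ≠ 0 ∧ lineCount Q v g = t).card

namespace IsElliptic

theorem card_isotropic (hQ : IsElliptic Q j) :
    ((Finset.univ.filter fun x => Q x = 0).card : ℚ) =
      (p : ℚ) ^ (2 * j + 1) - (p - 1) * (p : ℚ) ^ j := by
  have h := card_quadric hQ.sum_eq 0
  have hp : (p : ℂ) ≠ 0 := NeZero.ne _
  rw [hQ.card_eq, if_pos rfl] at h
  suffices ((Finset.univ.filter fun x => Q x = 0).card : ℂ) =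
      (p : ℂ) ^ (2 * j + 1) - (p - 1) * (p : ℂ) ^ j by exact_mod_cast this
  apply mul_left_cancel₀ hp
  rw [h]
  push_cast
  ring

theorem card_level (hQ : IsElliptic Q j) {c : ZMod p} (hc : c ≠ 0) :
    ((Finset.univ.filter fun x => Q x = c).card : ℚ) =
      (p : ℚ) ^ (2 * j + 1) + (p : ℚ) ^ j := by
  have h := card_quadric hQ.sum_eq c
  have hp : (p : ℂ) ≠ 0 := NeZero.ne _
  rw [hQ.card_eq, if_neg hc] at h
  suffices ((Finset.univ.filter fun x => Q x = c).card : ℂ) =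
      (p : ℂ) ^ (2 * j + 1) + (p : ℂ) ^ j by exact_mod_cast this
  apply mul_left_cancel₀ hp
  rw [h]
  push_cast
  ring

/-- The points of `Q + polar Q v = 0` on the hyperplane orthogonal to `g`: the count depends on `g`
only through `lineCount Q v g`. -/
theorem card_section (hQ : IsElliptic Q j) (v : V) {g : V} (hg : g ≠ 0) :
    ((Finset.univ.filter fun x => Q x + polar Q v x = 0 ∧ polar Q g x = 0).card : ℚ) =
      (p : ℚ) ^ (2 * j) - (p : ℚ) ^ j * (lineCount Q v g - 1) := by
  have h := card_quadric_hyperplane hQ.separatingLeft hQ.sum_eq v hg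
  have hp : (p : ℂ) ≠ 0 := NeZero.ne _
  rw [hQ.card_eq] at h
  suffices ((Finset.univ.filter fun x => Q x + polar Q v x = 0 ∧ polar Q g x = 0).card : ℂ) =
      (p : ℂ) ^ (2 * j) - (p : ℂ) ^ j * (lineCount Q v g - 1) by exact_mod_cast this
  apply mul_left_cancel₀ (pow_ne_zero 2 hp)
  rw [h]
  push_cast
  ring

theorem card_hyperplane (hQ : IsElliptic Q j) {v : V} (hv : v ≠ 0) :
    ((Finset.univ.filter fun x => polar Q v x = 0).card : ℚ) = (p : ℚ) ^ (2 * j + 1) := by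
  classical
  have h := card_zero_eq_sum (fun x => polar Q v x)
  have h1 : ∀ y : ZMod p, ∑ x : V, (ZMod.stdAddChar (y * polar Q v x) : ℂ) =
      if y = 0 then (Fintype.card V : ℂ) else 0 := by
    intro y
    have h2 := sum_stdAddChar_polar hQ.separatingLeft (y • v)
    simp only [polar_smul_left, smul_eq_mul, smul_eq_zero, hv, or_false] at h2
    exact h2
  simp only [h1, Finset.sum_ite_eq', Finset.mem_univ, if_true, hQ.card_eq] at h
  have hp : (p : ℂ) ≠ 0 := NeZero.ne _
  suffices ((Finset.univ.filter fun x => polar Q v x = 0).card : ℂ) = (p : ℂ) ^ (2 * j + 1) by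
    exact_mod_cast this
  apply mul_left_cancel₀ hp
  rw [h]
  push_cast
  ring

/-- The isotropic vectors orthogonal to `v`. -/
theorem card_isotropic_orthogonal (hQ : IsElliptic Q j) (hp : (2 : ZMod p) ≠ 0) {v : V}
    (hv : v ≠ 0) :
    ((Finset.univ.filter fun x => Q x = 0 ∧ polar Q v x = 0).card : ℚ) =
      if Q v = 0 then (p : ℚ) ^ (2 * j) - (p - 1) * (p : ℚ) ^ j else (p : ℚ) ^ (2 * j) := by
  have h := hQ.card_section 0 hv
  rw [lineCount_eq_rootCount] at h
  simp only [QuadraticMap.polar_zero_left, add_zero, QuadraticMap.map_zero,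
    rootCount_const_zero hp] at h
  rw [h]
  split_ifs <;> simp_all
  ring

theorem card_univ (hQ : IsElliptic Q j) :
    ((Finset.univ : Finset V).card : ℚ) = (p : ℚ) ^ (2 * j + 2) := by
  rw [Finset.card_univ, hQ.card_eq]
  push_cast
  ring


theorem directionCount_isotropic_max [DecidableEq V] (hQ : IsElliptic Q j)
    (hp : (2 : ZMod p) ≠ 0) {v : V} (hv : v ≠ 0) (hv0 : Q v = 0) :
    (directionCount Q v p : ℚ) = (p : ℚ) ^ (2 * j) - (p - 1) * (p : ℚ) ^ j - 1 := by
  have h := hQ.card_isotropic_orthogonal hp hv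
  rw [if_pos hv0] at h
  have h0 : (((Finset.univ : Finset V).filter fun g => g = 0).card : ℚ) = 1 := by
    simp [Finset.filter_eq']
  have hp2 := prime_ne_two_of_two_ne_zero hp
  have hp1 := (Fact.out : p.Prime).ne_one
  rw [← h, ← h0, directionCount]
  simp only [Finset.natCast_card_filter]
  rw [← Finset.sum_sub_distrib]
  refine Finset.sum_congr rfl fun g _ => ?_
  rw [lineCount_of_isotropic hp hv0]
  by_cases hg : g = 0
  · simp [hg]
  · by_cases h1 : Q g = 0 <;> by_cases h2 : polar Q v g = 0 <;> simp [hg, h1, h2, hp1.symm, hp2.symm]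

theorem directionCount_isotropic_two [DecidableEq V] (hQ : IsElliptic Q j)
    (hp : (2 : ZMod p) ≠ 0) {v : V} (hv : v ≠ 0) (hv0 : Q v = 0) :
    (directionCount Q v 2 : ℚ) = (p - 1) ^ 2 * (p : ℚ) ^ (2 * j) := by
  have h := hQ.card_isotropic_orthogonal hp hv
  rw [if_pos hv0] at h
  have hp2 := prime_ne_two_of_two_ne_zero hp
  -- inclusion-exclusion for the vectors with `Q g ≠ 0` and `polar Q v g ≠ 0`
  have hsum : (directionCount Q v 2 : ℚ) = ((Finset.univ : Finset V).card : ℚ) -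
      (Finset.univ.filter fun x => Q x = 0).card -
      (Finset.univ.filter fun x => polar Q v x = 0).card +
      (Finset.univ.filter fun x => Q x = 0 ∧ polar Q v x = 0).card := by
    have hu : ((Finset.univ : Finset V).card : ℚ) = ∑ _g : V, 1 := by simp
    rw [directionCount, hu]
    simp only [Finset.natCast_card_filter]
    rw [← Finset.sum_sub_distrib, ← Finset.sum_sub_distrib, ← Finset.sum_add_distrib]
    refine Finset.sum_congr rfl fun g _ => ?_
    rw [lineCount_of_isotropic hp hv0]
    by_cases hg : g = 0
    · simp [hg]
    · by_cases h1 : Q g = 0 <;> by_cases h2 : polar Q v g = 0 <;> simp [hg, h1, h2, hp2]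
  rw [hsum, h, hQ.card_isotropic, hQ.card_hyperplane hv, hQ.card_univ]
  ring

theorem directionCount_isotropic_one [DecidableEq V] (hQ : IsElliptic Q j)
    (hp : (2 : ZMod p) ≠ 0) {v : V} (hv : v ≠ 0) (hv0 : Q v = 0) :
    (directionCount Q v 1 : ℚ) = (p - 1) * (2 * (p : ℚ) ^ (2 * j) + (p : ℚ) ^ j) := by
  have h := hQ.card_isotropic_orthogonal hp hv
  rw [if_pos hv0] at h
  have hp1 := (Fact.out : p.Prime).ne_one
  have hsum : (directionCount Q v 1 : ℚ) = (Finset.univ.filter fun x => Q x = 0).card +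
      (Finset.univ.filter fun x => polar Q v x = 0).card -
      2 * (Finset.univ.filter fun x => Q x = 0 ∧ polar Q v x = 0).card := by
    rw [directionCount]
    simp only [Finset.natCast_card_filter]
    rw [Finset.mul_sum, ← Finset.sum_add_distrib, ← Finset.sum_sub_distrib]
    refine Finset.sum_congr rfl fun g _ => ?_
    rw [lineCount_of_isotropic hp hv0]
    by_cases hg : g = 0
    · simp [hg]
      norm_num
    · by_cases h1 : Q g = 0 <;> by_cases h2 : polar Q v g = 0 <;>
        norm_num [hg, h1, h2, hp1]
  rw [hsum, h, hQ.card_isotropic, hQ.card_hyperplane hv]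
  ring

/-- The cone of vectors `g` for which the line `v + t g` is tangent to the quadric `Q = 0` is the
orthogonal sum of the line spanned by `v` and of the isotropic vectors orthogonal to `v`. -/
theorem card_tangent_cone (hQ : IsElliptic Q j) (hp : (2 : ZMod p) ≠ 0) {v : V} (hv0 : Q v ≠ 0) :
    ((Finset.univ.filter fun g => polar Q v g ^ 2 - 4 * Q g * Q v = 0).card : ℚ) =
      (p : ℚ) ^ (2 * j + 1) := by
  have hv : v ≠ 0 := by
    rintro rfl
    simp at hv0
  have h := hQ.card_isotropic_orthogonal hp hv
  rw [if_neg hv0] at h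
  have h4 : (4 : ZMod p) ≠ 0 := by
    have : (4 : ZMod p) = 2 * 2 := by norm_num
    rw [this]
    exact mul_ne_zero hp hp
  have hpv : polar Q v v = 2 * Q v := by rw [QuadraticMap.polar_self]; simp
  -- the equation of the cone is invariant under translation by multiples of `v`
  have key : ∀ (s : ZMod p) (x : V), polar Q v (s • v + x) ^ 2 - 4 * Q (s • v + x) * Q v =
      polar Q v x ^ 2 - 4 * Q x * Q v := by
    intro s x
    rw [QuadraticMap.polar_add_right, QuadraticMap.polar_smul_right, QuadraticMap.map_add Q,
      QuadraticMap.map_smul, polar_smul_left, hpv]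
    simp only [smul_eq_mul]
    ring
  have hcard : (Finset.univ.filter fun g => polar Q v g ^ 2 - 4 * Q g * Q v = 0).card =
      ((Finset.univ : Finset (ZMod p)) ×ˢ
        (Finset.univ.filter fun x => Q x = 0 ∧ polar Q v x = 0)).card := by
    refine Finset.card_bij' (fun g _ => (polar Q v g / (2 * Q v),
      g - (polar Q v g / (2 * Q v)) • v)) (fun x _ => x.1 • v + x.2) ?_ ?_ ?_ ?_
    · intro g hg
      have hperp : polar Q v (g - (polar Q v g / (2 * Q v)) • v) = 0 := by
        rw [QuadraticMap.polar_sub_right, QuadraticMap.polar_smul_right, hpv, smul_eq_mul]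
        field_simp
        ring
      have h1 := key (polar Q v g / (2 * Q v)) (g - (polar Q v g / (2 * Q v)) • v)
      rw [add_sub_cancel, (Finset.mem_filter.1 hg).2, hperp] at h1
      simp only [Finset.mem_product, Finset.mem_filter, Finset.mem_univ, true_and]
      refine ⟨?_, hperp⟩
      have h2 : 4 * Q (g - (polar Q v g / (2 * Q v)) • v) * Q v = 0 := by
        linear_combination h1
      simpa [h4, hv0] using h2
    · rintro ⟨s, x⟩ hx
      simp only [Finset.mem_product, Finset.mem_filter, Finset.mem_univ, true_and] at hx ⊢
      rw [key, hx.1, hx.2]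
      ring
    · intro g _
      simp
    · rintro ⟨s, x⟩ hx
      simp only [Finset.mem_product, Finset.mem_filter, Finset.mem_univ, true_and] at hx
      have h1 : polar Q v (s • v + x) / (2 * Q v) = s := by
        rw [QuadraticMap.polar_add_right, QuadraticMap.polar_smul_right, hx.2, hpv, smul_eq_mul]
        field_simp
        ring
      dsimp only
      rw [h1, add_sub_cancel_left]
  rw [hcard, Finset.card_product, Finset.card_univ, ZMod.card]
  push_cast
  rw [h]
  ring

theorem directionCount_anisotropic_one [DecidableEq V] (hQ : IsElliptic Q j)
    (hp : (2 : ZMod p) ≠ 0) {v : V} (hv0 : Q v ≠ 0) :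
    (directionCount Q v 1 : ℚ) = (p - 1) * (2 * (p : ℚ) ^ (2 * j) - (p : ℚ) ^ j) := by
  have hv : v ≠ 0 := by
    rintro rfl
    simp at hv0
  have h := hQ.card_isotropic_orthogonal hp hv
  rw [if_neg hv0] at h
  -- the tangent cone contains the isotropic vectors orthogonal to `v`, and these have no intersection
  -- point, so they are removed both from the cone and from the isotropic vectors
  have hsum : (directionCount Q v 1 : ℚ) = (Finset.univ.filter fun x => Q x = 0).card +
      (Finset.univ.filter fun g => polar Q v g ^ 2 - 4 * Q g * Q v = 0).card -
      2 * (Finset.univ.filter fun x => Q x = 0 ∧ polar Q v x = 0).card := by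
    rw [directionCount]
    simp only [Finset.natCast_card_filter]
    rw [Finset.mul_sum, ← Finset.sum_add_distrib, ← Finset.sum_sub_distrib]
    refine Finset.sum_congr rfl fun g _ => ?_
    simp only [(lineCount_of_anisotropic hp hv0 g).2]
    by_cases hg : g = 0
    · simp [hg]
      norm_num
    · by_cases h1 : Q g = 0 <;> by_cases h2 : polar Q v g = 0 <;>
        norm_num [hg, h1, h2, hv0]
  rw [hsum, h, hQ.card_isotropic, hQ.card_tangent_cone hp hv0]
  ring

/-- Every point of the quadric lies on exactly `p - 1` of the parametrized lines through the
anisotropic vector `v`, so the average intersection number is known. -/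
theorem sum_lineCount (hQ : IsElliptic Q j) {v : V} (hv0 : Q v ≠ 0) :
    ∑ g : V, (lineCount Q v g : ℚ) =
      (p - 1) * ((p : ℚ) ^ (2 * j + 1) - (p - 1) * (p : ℚ) ^ j) := by
  simp only [lineCount, Finset.natCast_card_filter]
  rw [Finset.sum_comm, ← Finset.sum_filter_add_sum_filter_not Finset.univ
    (fun t : ZMod p => t ≠ 0)]
  have h1 : ∀ t : ZMod p, t ≠ 0 → ∑ g : V, (if Q (v + t • g) = 0 then (1 : ℚ) else 0) =
      (p : ℚ) ^ (2 * j + 1) - (p - 1) * (p : ℚ) ^ j := by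
    intro t ht
    rw [← hQ.card_isotropic, Finset.natCast_card_filter]
    exact Equiv.sum_comp ((MulAction.toPerm (Units.mk0 t ht)).trans (Equiv.addLeft v))
      (fun x => if Q x = 0 then (1 : ℚ) else 0)
  rw [Finset.sum_congr rfl fun t ht => h1 t (Finset.mem_filter.1 ht).2]
  have h2 : (((Finset.univ.filter fun t : ZMod p => t ≠ 0).card : ℕ) : ℚ) = p - 1 := by
    rw [Finset.filter_ne', Finset.card_erase_of_mem (Finset.mem_univ _), Finset.card_univ,
      ZMod.card, Nat.cast_sub (Fact.out : p.Prime).one_le, Nat.cast_one]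
  rw [Finset.sum_const, nsmul_eq_mul, h2]
  simp [Finset.filter_eq', hv0]

theorem directionCount_anisotropic_two [DecidableEq V] (hQ : IsElliptic Q j)
    (hp : (2 : ZMod p) ≠ 0) {v : V} (hv0 : Q v ≠ 0) :
    (directionCount Q v 2 : ℚ) =
      (p - 1) * (p - 2) / 2 * ((p : ℚ) ^ (2 * j) - (p : ℚ) ^ j) := by
  have h1 := hQ.directionCount_anisotropic_one hp hv0
  have h2 := hQ.sum_lineCount hv0
  have hsum : ∑ g : V, (lineCount Q v g : ℚ) =
      directionCount Q v 1 + 2 * directionCount Q v 2 := by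
    rw [directionCount, directionCount]
    simp only [Finset.natCast_card_filter]
    rw [Finset.mul_sum, ← Finset.sum_add_distrib]
    refine Finset.sum_congr rfl fun g _ => ?_
    by_cases hg : g = 0
    · simp [hg, lineCount_zero_right hv0]
    · rcases (lineCount_of_anisotropic hp hv0 g).1 with h | h | h <;> simp [h, hg]
  linear_combination (hsum.symm.trans h2) / 2 - h1 / 2

theorem directionCount_anisotropic_zero [DecidableEq V] (hQ : IsElliptic Q j)
    (hp : (2 : ZMod p) ≠ 0) {v : V} (hv0 : Q v ≠ 0) :
    (directionCount Q v 0 : ℚ) =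
      (p : ℚ) ^ (2 * j) + (p - 1) / 2 * ((p : ℚ) ^ (2 * j + 1) + (p : ℚ) ^ (j + 1)) - 1 := by
  have h1 := hQ.directionCount_anisotropic_one hp hv0
  have h2 := hQ.directionCount_anisotropic_two hp hv0
  have hsum : ((Finset.univ : Finset V).card : ℚ) - 1 =
      directionCount Q v 0 + directionCount Q v 1 + directionCount Q v 2 := by
    have h0 : (((Finset.univ : Finset V).filter fun g => g = 0).card : ℚ) = 1 := by
      simp [Finset.filter_eq']
    have hu : ((Finset.univ : Finset V).card : ℚ) = ∑ _g : V, 1 := by simp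
    rw [directionCount, directionCount, directionCount, hu, ← h0]
    simp only [Finset.natCast_card_filter]
    rw [← Finset.sum_sub_distrib, ← Finset.sum_add_distrib, ← Finset.sum_add_distrib]
    refine Finset.sum_congr rfl fun g _ => ?_
    by_cases hg : g = 0
    · simp [hg]
    · rcases (lineCount_of_anisotropic hp hv0 g).1 with h | h | h <;> simp [h, hg]
  rw [hQ.card_univ] at hsum
  linear_combination -hsum - h1 - h2

end IsElliptic

end EllipticForms

/-! ### The form `Tr(x ^ (p + 1))` -/

section TraceNormForm

variable (p : ℕ) [Fact p.Prime] (F : Type*) [Field F] [Algebra (ZMod p) F]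

/-- The quadratic form `x ↦ Tr(x ^ (p + 1))` on a field of characteristic `p`, obtained from the
bilinear form `(x, y) ↦ Tr(x y ^ p)`. -/
noncomputable def traceNormForm : QuadraticForm (ZMod p) F :=
  LinearMap.BilinMap.toQuadraticMap
    ((Algebra.traceForm (ZMod p) F).compl₂ (FiniteField.frobeniusAlgHom (ZMod p) F).toLinearMap)

variable {p F}

theorem traceNormForm_apply (x : F) :
    traceNormForm p F x = Algebra.trace (ZMod p) F (x ^ (p + 1)) := by
  simp [traceNormForm, Algebra.traceForm_apply, ZMod.card, pow_succ']

theorem polar_traceNormForm (x y : F) : polar (traceNormForm p F) x y =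
    Algebra.trace (ZMod p) F (x * y ^ p) + Algebra.trace (ZMod p) F (y * x ^ p) := by
  rw [traceNormForm, LinearMap.BilinMap.polar_toQuadraticMap]
  simp [Algebra.traceForm_apply, ZMod.card]

variable [Fintype F]

theorem trace_pow_char (x : F) :
    Algebra.trace (ZMod p) F (x ^ p) = Algebra.trace (ZMod p) F x := by
  have h := Algebra.trace_eq_of_algEquiv
    (FiniteField.frobeniusAlgEquivOfAlgebraic (ZMod p) F) x
  simpa [ZMod.card] using h

theorem polar_traceNormForm_one (x : F) :
    polar (traceNormForm p F) 1 x = 2 * Algebra.trace (ZMod p) F x := by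
  rw [polar_traceNormForm, one_mul, one_pow, mul_one, trace_pow_char, two_mul]

theorem traceNormForm_one : traceNormForm p F 1 = Module.finrank (ZMod p) F := by
  have h := Algebra.trace_algebraMap (S := F) (1 : ZMod p)
  rw [traceNormForm_apply, one_pow]
  simpa using h

theorem separatingLeft_traceNormForm (hp : p ≠ 2) {k : ℕ} (hk : Odd k)
    (hF : Fintype.card F = p ^ (2 * k)) : (traceNormForm p F).polarBilin.SeparatingLeft := by
  have hchar : CharP F p := charP_of_injective_algebraMap' (ZMod p) p
  have hodd : Odd p := (Fact.out : p.Prime).odd_of_ne_two hp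
  intro x hx
  -- `Tr(y x ^ p) = Tr(y ^ p x ^ (p ^ 2))`, so `x + x ^ (p ^ 2)` is orthogonal to all `y ^ p`
  have h1 : ∀ z : F, Algebra.traceForm (ZMod p) F (x + x ^ (p ^ 2)) z = 0 := by
    intro z
    obtain ⟨y, rfl⟩ := (FiniteField.frobeniusAlgEquivOfAlgebraic (ZMod p) F).surjective z
    have h2 := hx y
    rw [QuadraticMap.polarBilin_apply_apply, polar_traceNormForm, ← trace_pow_char (y * x ^ p),
      ← map_add] at h2
    rw [Algebra.traceForm_apply, ← h2]
    congr 1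
    simp only [FiniteField.frobeniusAlgEquivOfAlgebraic_apply, ZMod.card]
    ring
  have h3 : x + x ^ (p ^ 2) = 0 := (traceForm_nondegenerate (ZMod p) F).1 _ h1
  have h4 : x ^ (p ^ 2) = -x := by linear_combination h3
  -- iterating `x ↦ x ^ (p ^ 2) = -x` an odd number `k` of times gives the identity of `F`
  have h5 : ∀ i : ℕ, x ^ ((p ^ 2) ^ i) = (-1) ^ i * x := by
    intro i
    induction i with
    | zero => simp
    | succ i ih =>
      rw [pow_succ (p ^ 2), pow_mul, ih, mul_pow, h4, ← pow_mul, mul_comm i, pow_mul,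
        hodd.pow.neg_one_pow]
      ring
  have h6 := h5 k
  rw [← pow_mul, ← hF, FiniteField.pow_card, hk.neg_one_pow] at h6
  have h7 : (2 : F) * x = 0 := by linear_combination h6
  have h8 : (2 : F) ≠ 0 := Ring.two_ne_zero (by rwa [ringChar.eq F p])
  simpa [h8] using h7

theorem exists_generator_units : ∃ w : F, IsPrimitiveRoot w (Fintype.card F - 1) ∧
    ∀ x : F, x ≠ 0 → ∃ i : ℕ, w ^ i = x := by
  obtain ⟨w, hw⟩ := IsCyclic.exists_monoid_generator (α := Fˣ)
  refine ⟨w, ?_, fun x hx => ?_⟩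
  · have h := IsPrimitiveRoot.orderOf w
    rw [orderOf_eq_card_of_forall_mem_powers hw, Nat.card_units, Nat.card_eq_fintype_card] at h
    exact IsPrimitiveRoot.coe_units_iff.2 h
  · obtain ⟨i, hi⟩ := hw (Units.mk0 x hx)
    exact ⟨i, by simpa using congrArg Units.val hi⟩

theorem sub_one_mul_add_one_dvd (p k : ℕ) : (p - 1) * (p + 1) ∣ p ^ (2 * k) - 1 := by
  have h : (p - 1) * (p + 1) = p ^ 2 - 1 ^ 2 := by rw [Nat.sq_sub_sq, mul_comm]
  rw [h, pow_mul, one_pow]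
  simpa using Nat.sub_dvd_pow_sub_pow (p ^ 2) 1 k

/-- Every element of the prime field is a `(p + 1)`-st power in a field of even degree. -/
theorem exists_pow_eq_algebraMap {k : ℕ} (hF : Fintype.card F = p ^ (2 * k)) {y : ZMod p}
    (hy : y ≠ 0) : ∃ u : F, u ≠ 0 ∧ u ^ (p + 1) = algebraMap (ZMod p) F y := by
  obtain ⟨w, hw, hgen⟩ := exists_generator_units (F := F)
  have hy' : algebraMap (ZMod p) F y ≠ 0 := by simpa using hy
  obtain ⟨i, hi⟩ := hgen _ hy'
  have h1 : w ^ (i * (p - 1)) = 1 := by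
    rw [pow_mul, hi, ← map_pow, ZMod.pow_card_sub_one_eq_one hy, map_one]
  have h2 := hw.dvd_of_pow_eq_one _ h1
  rw [hF] at h2
  have h3 := (sub_one_mul_add_one_dvd p k).trans h2
  rw [mul_comm i] at h3
  obtain ⟨c, rfl⟩ := Nat.dvd_of_mul_dvd_mul_left
    (Nat.sub_pos_of_lt (Fact.out : p.Prime).one_lt) h3
  refine ⟨w ^ c, ?_, by rw [← hi]; ring⟩
  intro h0
  apply hy'
  rw [← hi, mul_comm, pow_mul, h0, zero_pow (by omega)]

/-- Multiplication by a `(p + 1)`-st root of `y` is a similitude of ratio `y`, so the exponential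
sum does not depend on `y`. -/
theorem quadraticSum_traceNormForm {k : ℕ} (hF : Fintype.card F = p ^ (2 * k)) {y : ZMod p}
    (hy : y ≠ 0) : quadraticSum (traceNormForm p F) y = quadraticSum (traceNormForm p F) 1 := by
  obtain ⟨u, hu, huy⟩ := exists_pow_eq_algebraMap hF hy
  rw [quadraticSum, quadraticSum, ← Equiv.sum_comp (Equiv.mulLeft₀ u hu)
    (fun x => ZMod.stdAddChar (1 * traceNormForm p F x))]
  refine Finset.sum_congr rfl fun x _ => ?_
  congr 1
  rw [traceNormForm_apply, traceNormForm_apply, Equiv.mulLeft₀_apply, mul_pow, huy,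
    ← Algebra.smul_def, map_smul, smul_eq_mul, one_mul]

/-- The `(p + 1)`-st roots of unity act freely on every level set of `x ↦ Tr(x ^ (p + 1))` that
avoids `0`. -/
theorem add_one_dvd_card_level {k : ℕ} (hF : Fintype.card F = p ^ (2 * k)) {c : ZMod p}
    (hc : c ≠ 0) : p + 1 ∣ (Finset.univ.filter fun x => traceNormForm p F x = c).card := by
  classical
  obtain ⟨w, hw, -⟩ := exists_generator_units (F := F)
  obtain ⟨e, he⟩ := (Dvd.intro_left _ rfl : p + 1 ∣ (p - 1) * (p + 1)).trans
    (sub_one_mul_add_one_dvd p k)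
  rw [hF] at hw
  have hpos : 0 < p ^ (2 * k) - 1 := by
    rw [← hF]
    exact Nat.sub_pos_of_lt Fintype.one_lt_card
  have hroot := hw.pow hpos (he.trans (mul_comm _ _))
  rw [Finset.card_eq_sum_card_fiberwise (f := fun x : F => x ^ (p + 1))
    (t := Finset.univ.filter fun z => Algebra.trace (ZMod p) F z = c)]
  · refine Finset.dvd_sum fun z hz => ?_
    have hz' := (Finset.mem_filter.1 hz).2
    have hz0 : z ≠ 0 := by
      rintro rfl
      exact hc (by simpa using hz'.symm)
    have h1 : (Finset.univ.filter fun x => traceNormForm p F x = c).filter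
        (fun x => x ^ (p + 1) = z) = (Polynomial.nthRoots (p + 1) z).toFinset := by
      ext x
      simp only [Finset.mem_filter, Finset.mem_univ, true_and, Multiset.mem_toFinset,
        Polynomial.mem_nthRoots p.succ_pos, traceNormForm_apply]
      constructor
      · exact fun h => h.2
      · rintro rfl
        exact ⟨hz', rfl⟩
    rw [h1, Multiset.toFinset_card_of_nodup (hroot.nthRoots_nodup hz0), hroot.card_nthRoots]
    split_ifs <;> simp
  · intro x hx
    simpa [traceNormForm_apply] using hx

/-- In degree `2 (j + 1)` with `j` even, the form `x ↦ Tr(x ^ (p + 1))` is of minus type: the sign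
is found from the number of solutions of `Tr(x ^ (p + 1)) = 1` modulo `p + 1`. -/
theorem isElliptic_traceNormForm (hp : p ≠ 2) {j : ℕ} (hj : Even j)
    (hF : Fintype.card F = p ^ (2 * j + 2)) : IsElliptic (traceNormForm p F) j := by
  have hF' : Fintype.card F = p ^ (2 * (j + 1)) := hF
  have hsep := separatingLeft_traceNormForm hp hj.add_one hF'
  have hS : ∀ y ≠ 0, quadraticSum (traceNormForm p F) y = quadraticSum (traceNormForm p F) 1 :=
    fun y hy => quadraticSum_traceNormForm hF' hy
  refine ⟨hsep, hF, fun y hy => ?_⟩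
  rw [hS y hy]
  have hsq := sq_eq_card_of_quadraticSum_eq hsep hS
  have hsq' : quadraticSum (traceNormForm p F) 1 ^ 2 = ((p : ℂ) ^ (j + 1)) ^ 2 := by
    rw [hsq, hF]
    push_cast
    ring
  rcases sq_eq_sq_iff_eq_or_eq_neg.1 hsq' with h | h
  · exfalso
    have hcard := card_quadric hS 1
    rw [h, hF, if_neg one_ne_zero] at hcard
    obtain ⟨d, hd⟩ := add_one_dvd_card_level hF' (one_ne_zero (α := ZMod p))
    rw [hd] at hcard
    have hp0 : (p : ℂ) ≠ 0 := NeZero.ne _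
    have h1 : (((p : ℤ) + 1) * d : ℤ) = (p : ℤ) ^ (2 * j + 1) - (p : ℤ) ^ j := by
      have : ((p : ℂ) + 1) * d = (p : ℂ) ^ (2 * j + 1) - (p : ℂ) ^ j := by
        apply mul_left_cancel₀ hp0
        push_cast at hcard
        rw [hcard]
        ring
      exact_mod_cast this
    -- modulo `p + 1` the number `p ^ (2 * j + 1) - p ^ j` is `-1 - 1`
    have hmod : (p : ℤ) ≡ -1 [ZMOD (p + 1)] := by
      rw [Int.modEq_iff_dvd]
      exact ⟨-1, by ring⟩
    have h2 : (p : ℤ) ^ (2 * j + 1) - (p : ℤ) ^ j ≡ (-1) ^ (2 * j + 1) - (-1) ^ j [ZMOD (p + 1)] :=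
      (hmod.pow _).sub (hmod.pow _)
    rw [hj.neg_one_pow, (odd_two_mul_add_one j).neg_one_pow, ← h1] at h2
    have h3 : ((p : ℤ) + 1) ∣ -2 := by
      have := (Int.modEq_zero_iff_dvd.2 (Dvd.intro _ rfl : ((p : ℤ) + 1) ∣ (p + 1) * d))
      exact Int.modEq_zero_iff_dvd.1 (h2.symm.trans this)
    have h4 := Int.le_of_dvd (by norm_num) ((dvd_neg.1 h3) : ((p : ℤ) + 1) ∣ 2)
    have := (Fact.out : p.Prime).two_le
    omega
  · exact h

/-- The linear automorphism `φ` with `Tr(φ(g) x) = polar g x` identifies the vectors of the quadratic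
space with the parameters of the codewords. -/
theorem exists_trace_dual (h : (traceNormForm p F).polarBilin.SeparatingLeft) :
    ∃ φ : F ≃ₗ[ZMod p] F, ∀ g x : F,
      Algebra.trace (ZMod p) F (φ g * x) = polar (traceNormForm p F) g x := by
  have hnd := traceForm_nondegenerate (ZMod p) F
  let e := LinearMap.BilinForm.toDual (Algebra.traceForm (ZMod p) F) hnd
  have hinj : Function.Injective (e.symm.toLinearMap ∘ₗ (traceNormForm p F).polarBilin) := by
    rw [LinearMap.coe_comp]
    refine e.symm.injective.comp ?_
    exact LinearMap.ker_eq_bot.1 (LinearMap.separatingLeft_iff_ker_eq_bot.1 h)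
  refine ⟨LinearEquiv.ofInjectiveEndo _ hinj, fun g x => ?_⟩
  have h1 : e (e.symm ((traceNormForm p F).polarBilin g)) x = (traceNormForm p F).polarBilin g x := by
    rw [LinearEquiv.apply_symm_apply]
  exact h1

end TraceNormForm

/-! ### Weights of the codewords -/

section CodeWeights

variable {p : ℕ} [Fact p.Prime] {F : Type*} [Field F] [Algebra (ZMod p) F]

/-- The encoding map `b ↦ (Tr(b d_1), …, Tr(b d_n))` of the code `traceCode p d`. -/
noncomputable def traceWord (p : ℕ) [Fact p.Prime] {F : Type*} [Field F] [Algebra (ZMod p) F] {n : ℕ}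
    (d : Fin n → F) : F →ₗ[ZMod p] (Fin n → ZMod p) :=
  LinearMap.pi fun i => Algebra.trace (ZMod p) F ∘ₗ LinearMap.mulRight (ZMod p) (d i)

theorem traceWord_apply {n : ℕ} (d : Fin n → F) (b : F) (i : Fin n) :
    traceWord p d b i = Algebra.trace (ZMod p) F (b * d i) := rfl

theorem traceCode_eq_range {n : ℕ} (d : Fin n → F) :
    traceCode p d = LinearMap.range (traceWord p d) := by
  ext c
  constructor
  · rintro ⟨x, rfl⟩
    exact ⟨x, rfl⟩
  · rintro ⟨x, rfl⟩
    exact ⟨x, rfl⟩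

/-- The vector `-1/2`, for which completing the square in `Tr(x ^ (p + 1) - x)` removes the linear
term. -/
noncomputable def squareCenter (p : ℕ) [Fact p.Prime] (F : Type*) [Field F] [Algebra (ZMod p) F] :
    F :=
  (-(2 : ZMod p)⁻¹) • (1 : F)

theorem squareCenter_ne_zero (hp : (2 : ZMod p) ≠ 0) : squareCenter p F ≠ 0 := by
  simp [squareCenter, hp]

variable [Fintype F]

theorem polar_squareCenter (hp : (2 : ZMod p) ≠ 0) (x : F) :
    polar (traceNormForm p F) (squareCenter p F) x = -Algebra.trace (ZMod p) F x := by
  rw [squareCenter, polar_smul_left, polar_traceNormForm_one, smul_eq_mul]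
  field_simp

theorem traceNormForm_squareCenter (hp : (2 : ZMod p) ≠ 0) :
    traceNormForm p F (squareCenter p F) = 0 ↔ p ∣ Module.finrank (ZMod p) F := by
  rw [squareCenter, QuadraticMap.map_smul, traceNormForm_one, smul_eq_mul, mul_eq_zero,
    ← ZMod.natCast_eq_zero_iff]
  simp [hp]

theorem mem_definingSet_iff (hp : (2 : ZMod p) ≠ 0) (x : F) :
    x ∈ definingSet p F ↔ x ≠ 0 ∧
      traceNormForm p F x + polar (traceNormForm p F) (squareCenter p F) x = 0 := by
  rw [polar_squareCenter hp, traceNormForm_apply, ← sub_eq_add_neg, ← map_sub]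
  rfl

variable {n : ℕ} {d : Fin n → F}

/-- The quadric `Q + polar Q v = 0` with `v = -1/2` is the defining set together with `0`. -/
theorem length_add_one (hp : (2 : ZMod p) ≠ 0) (hd : Function.Injective d)
    (hD : Set.range d = definingSet p F) :
    n + 1 = (Finset.univ.filter fun x =>
      traceNormForm p F x + polar (traceNormForm p F) (squareCenter p F) x = 0).card := by
  classical
  have h : (Finset.univ.filter fun x : F =>
      traceNormForm p F x + polar (traceNormForm p F) (squareCenter p F) x = 0) =
      insert 0 (Finset.univ.map ⟨d, hd⟩) := by
    ext x
    have hx := mem_definingSet_iff hp x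
    rw [← hD] at hx
    by_cases h0 : x = 0
    · simp [h0]
    · simpa [h0] using hx.symm
  rw [h, Finset.card_insert_of_notMem, Finset.card_map, Finset.card_univ, Fintype.card_fin]
  intro h0
  have h1 : (0 : F) ∈ Set.range d := by simpa using h0
  rw [hD] at h1
  exact h1.1 rfl

/-- The zero coordinates of the codeword of `b`, and the point `0`, are the points of the quadric on
the hyperplane `Tr(b x) = 0`. -/
theorem hammingNorm_traceWord_add (hp : (2 : ZMod p) ≠ 0) (hd : Function.Injective d)
    (hD : Set.range d = definingSet p F) (b : F) :
    hammingNorm (traceWord p d b) + (Finset.univ.filter fun x =>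
      traceNormForm p F x + polar (traceNormForm p F) (squareCenter p F) x = 0 ∧
        Algebra.trace (ZMod p) F (b * x) = 0).card =
      (Finset.univ.filter fun x =>
        traceNormForm p F x + polar (traceNormForm p F) (squareCenter p F) x = 0).card := by
  classical
  have h : hammingNorm (traceWord p d b) = ((Finset.univ.filter fun x =>
      traceNormForm p F x + polar (traceNormForm p F) (squareCenter p F) x = 0).filter
        fun x => ¬ Algebra.trace (ZMod p) F (b * x) = 0).card := by
    rw [hammingNorm, ← Finset.card_map ⟨d, hd⟩]
    congr 1
    ext x
    have hx := mem_definingSet_iff hp x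
    rw [← hD] at hx
    simp only [Finset.mem_map, Finset.mem_filter, Finset.mem_univ, true_and,
      Function.Embedding.coeFn_mk, traceWord_apply]
    constructor
    · rintro ⟨i, hi, rfl⟩
      exact ⟨(hx.1 ⟨i, rfl⟩).2, (Finset.mem_filter.1 hi).2⟩
    · rintro ⟨h1, h2⟩
      obtain ⟨i, rfl⟩ := hx.2 ⟨by rintro rfl; simp at h2, h1⟩
      exact ⟨i, Finset.mem_filter.2 ⟨Finset.mem_univ _, h2⟩, rfl⟩
  rw [h, ← Finset.filter_filter, add_comm, Finset.card_filter_add_card_filter_not]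

/-- The weight of the codeword with parameter dual to `g` is an affine function of the number of
points in which the line through `-1/2` with direction `g` meets the quadric. -/
theorem hammingNorm_traceWord_dual (hp : (2 : ZMod p) ≠ 0) (hd : Function.Injective d)
    (hD : Set.range d = definingSet p F) {j : ℕ} (hQ : IsElliptic (traceNormForm p F) j)
    {φ : F ≃ₗ[ZMod p] F}
    (hφ : ∀ g x : F, Algebra.trace (ZMod p) F (φ g * x) = polar (traceNormForm p F) g x)
    {g : F} (hg : g ≠ 0) :
    (hammingNorm (traceWord p d (φ g)) : ℚ) = (n : ℚ) + 1 - (p : ℚ) ^ (2 * j) - (p : ℚ) ^ j +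
      (p : ℚ) ^ j * lineCount (traceNormForm p F) (squareCenter p F) g := by
  have h1 := hammingNorm_traceWord_add hp hd hD (φ g)
  rw [← length_add_one hp hd hD] at h1
  simp only [hφ] at h1
  have h2 := hQ.card_section (squareCenter p F) hg
  have h3 := congrArg (Nat.cast : ℕ → ℚ) h1
  rw [Nat.cast_add, Nat.cast_add, Nat.cast_one] at h3
  rw [h2] at h3
  linear_combination h3

theorem length_eq (hp : (2 : ZMod p) ≠ 0) (hd : Function.Injective d)
    (hD : Set.range d = definingSet p F) {j : ℕ} (hQ : IsElliptic (traceNormForm p F) j) :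
    (n : ℚ) + 1 = if p ∣ Module.finrank (ZMod p) F then
      (p : ℚ) ^ (2 * j + 1) - (p - 1) * (p : ℚ) ^ j else (p : ℚ) ^ (2 * j + 1) + (p : ℚ) ^ j := by
  have h1 := length_add_one hp hd hD
  rw [card_quadric_translate] at h1
  have h2 := congrArg (Nat.cast : ℕ → ℚ) h1
  rw [Nat.cast_add, Nat.cast_one] at h2
  rw [h2]
  split_ifs with h
  · rw [(traceNormForm_squareCenter hp).2 h, hQ.card_isotropic]
  · rw [hQ.card_level (mt (traceNormForm_squareCenter hp).1 h)]

end CodeWeights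

/-! ### Weight enumeration from an affine parameter -/

section WeightDistribution

variable {p n : ℕ} {V : Type*} [Fintype V] {C : Submodule (ZMod p) (Fin n → ZMod p)}
  {c : V → Fin n → ZMod p}

theorem weightCount_eq_card (hc : Function.Injective c) (hC : ∀ x, x ∈ C ↔ x ∈ Set.range c)
    (w : ℕ) : weightCount C w = (Finset.univ.filter fun g => hammingNorm (c g) = w).card := by
  classical
  have h : {x : Fin n → ZMod p | x ∈ C ∧ hammingNorm x = w} =
      c '' ((Finset.univ.filter fun g => hammingNorm (c g) = w : Finset V) : Set V) := by
    ext x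
    simp only [Set.mem_ofPred_eq, hC, Set.mem_range, Set.mem_image, Finset.coe_filter,
      Finset.mem_univ, true_and]
    constructor
    · rintro ⟨⟨g, rfl⟩, hg⟩
      exact ⟨g, hg, rfl⟩
    · rintro ⟨g, hg, rfl⟩
      exact ⟨⟨g, rfl⟩, hg⟩
  rw [weightCount, h, Set.ncard_image_of_injective _ hc, Set.ncard_coe_finset]

variable [Zero V] {T : V → ℕ} {α β : ℚ}

/-- The number of nonzero weights, when the weight of the nonzero codewords is an injective affine
function of an auxiliary parameter `T`. -/
theorem numNonzeroWeights_eq_ncard (hc : Function.Injective c)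
    (hC : ∀ x, x ∈ C ↔ x ∈ Set.range c) (h0 : c 0 = 0) (hβ : β ≠ 0)
    (hT : ∀ g ≠ 0, (hammingNorm (c g) : ℚ) = α + β * T g) :
    numNonzeroWeights C = Set.ncard (T '' {g | g ≠ 0}) := by
  have h1 : {i : ℕ | 1 ≤ i ∧ i ≤ n ∧ weightCount C i ≠ 0} =
      (fun g => hammingNorm (c g)) '' {g | g ≠ 0} := by
    ext i
    simp only [Set.mem_ofPred_eq, weightCount_eq_card hc hC, Set.mem_image, Finset.card_ne_zero,
      Finset.Nonempty, Finset.mem_filter, Finset.mem_univ, true_and]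
    constructor
    · rintro ⟨h1, -, g, rfl⟩
      refine ⟨g, ?_, rfl⟩
      rintro rfl
      simp [h0] at h1
    · rintro ⟨g, hg, rfl⟩
      refine ⟨Nat.one_le_iff_ne_zero.2 fun h => hg (hc ?_), ?_, g, rfl⟩
      · rw [h0]
        exact hammingNorm_eq_zero.1 h
      · simpa using hammingNorm_le_card_fintype (x := c g)
  have h2 : (Nat.cast : ℕ → ℚ) '' ((fun g => hammingNorm (c g)) '' {g | g ≠ 0}) =
      (fun t : ℕ => α + β * (t : ℚ)) '' (T '' {g | g ≠ 0}) := by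
    rw [Set.image_image, Set.image_image]
    exact Set.image_congr fun g hg => hT g hg
  rw [numNonzeroWeights, h1, ← Set.ncard_image_of_injective _ (Nat.cast_injective (R := ℚ)), h2,
    Set.ncard_image_of_injective]
  intro s t hst
  simpa [hβ] using hst

theorem weightCount_zero (hc : Function.Injective c)
    (hC : ∀ x, x ∈ C ↔ x ∈ Set.range c) (h0 : c 0 = 0) : weightCount C 0 = 1 := by
  rw [weightCount_eq_card hc hC, Finset.card_eq_one]
  refine ⟨0, ?_⟩
  ext g
  simp only [Finset.mem_filter, Finset.mem_univ, true_and, Finset.mem_singleton,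
    hammingNorm_eq_zero]
  rw [← h0]
  exact hc.eq_iff

theorem weightCount_eq_of_affine [DecidableEq V] (hc : Function.Injective c)
    (hC : ∀ x, x ∈ C ↔ x ∈ Set.range c) (h0 : c 0 = 0) (hβ : β ≠ 0)
    (hT : ∀ g ≠ 0, (hammingNorm (c g) : ℚ) = α + β * T g) {w t : ℕ} (hw : w ≠ 0)
    (hwt : (w : ℚ) = α + β * t) :
    weightCount C w = (Finset.univ.filter fun g => g ≠ 0 ∧ T g = t).card := by
  rw [weightCount_eq_card hc hC]
  congr 1
  ext g
  simp only [Finset.mem_filter, Finset.mem_univ, true_and]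
  by_cases hg : g = 0
  · simp [hg, h0, hw.symm]
  · have h := hT g hg
    simp only [hg, ne_eq, not_false_eq_true, true_and]
    rw [← Nat.cast_inj (R := ℚ), h, hwt]
    simp [hβ]

theorem weightCount_eq_zero_of_affine (hc : Function.Injective c)
    (hC : ∀ x, x ∈ C ↔ x ∈ Set.range c) (h0 : c 0 = 0)
    (hT : ∀ g ≠ 0, (hammingNorm (c g) : ℚ) = α + β * T g) {w : ℕ} (hw : w ≠ 0)
    (hwt : ∀ g ≠ 0, (w : ℚ) ≠ α + β * T g) : weightCount C w = 0 := by
  rw [weightCount_eq_card hc hC, Finset.card_eq_zero, Finset.filter_eq_empty_iff]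
  intro g _ h
  by_cases hg : g = 0
  · subst hg
    simp [h0, hw.symm] at h
  · exact hwt g hg (by rw [← hT g hg, h])

end WeightDistribution

/-! ### The number of values of the intersection number -/

section NumberOfWeights

variable {p : ℕ} [Fact p.Prime] {V : Type*} [AddCommGroup V] [Module (ZMod p) V] [Fintype V]
  {Q : QuadraticForm (ZMod p) V} {j : ℕ}

theorem mem_image_lineCount_iff [DecidableEq V] {v : V} {t : ℕ} :
    t ∈ lineCount Q v '' {g | g ≠ 0} ↔ (directionCount Q v t : ℚ) ≠ 0 := by
  rw [Nat.cast_ne_zero, directionCount, Finset.card_ne_zero, Finset.Nonempty]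
  simp

theorem IsElliptic.ncard_lineCount_isotropic (hQ : IsElliptic Q j) (hp : (2 : ZMod p) ≠ 0)
    (hj : 2 ≤ j) {v : V} (hv : v ≠ 0) (hv0 : Q v = 0) :
    Set.ncard (lineCount Q v '' {g | g ≠ 0}) = 3 := by
  classical
  have hp2 := prime_ne_two_of_two_ne_zero hp
  have hp1 := (Fact.out : p.Prime).ne_one
  have hpq : (2 : ℚ) ≤ p := by exact_mod_cast (Fact.out : p.Prime).two_le
  have hX : (p : ℚ) ^ 2 ≤ (p : ℚ) ^ j := pow_le_pow_right₀ (by linarith) hj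
  have hX2 : (p : ℚ) ^ (2 * j) = (p : ℚ) ^ j * (p : ℚ) ^ j := by ring
  have h : lineCount Q v '' {g | g ≠ 0} = (({1, 2, p} : Finset ℕ) : Set ℕ) := by
    ext t
    simp only [Finset.coe_insert, Finset.coe_singleton, Set.mem_insert_iff, Set.mem_singleton_iff]
    constructor
    · rintro ⟨g, -, rfl⟩
      rw [lineCount_of_isotropic hp hv0]
      split_ifs <;> simp
    · rintro (rfl | rfl | rfl) <;> rw [mem_image_lineCount_iff]
      · rw [hQ.directionCount_isotropic_one hp hv hv0]
        have : (0 : ℚ) < (p - 1) := by linarith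
        positivity
      · rw [hQ.directionCount_isotropic_two hp hv hv0]
        have : (0 : ℚ) < (p - 1) := by linarith
        positivity
      · rw [hQ.directionCount_isotropic_max hp hv hv0, hX2]
        apply ne_of_gt
        nlinarith
  rw [h, Set.ncard_coe_finset, Finset.card_insert_of_notMem, Finset.card_pair hp2.symm]
  simp [hp1.symm]

/-- For `j = 0` the form is anisotropic on a plane, and the value `2` is not attained. -/
theorem IsElliptic.ncard_lineCount_anisotropic (hQ : IsElliptic Q j) (hp : (2 : ZMod p) ≠ 0)
    {v : V} (hv0 : Q v ≠ 0) :
    Set.ncard (lineCount Q v '' {g | g ≠ 0}) = if j = 0 then 2 else 3 := by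
  classical
  have hp2 := prime_ne_two_of_two_ne_zero hp
  have hpq : (2 : ℚ) < p := by
    exact_mod_cast lt_of_le_of_ne (Fact.out : p.Prime).two_le hp2.symm
  have hX : (1 : ℚ) ≤ (p : ℚ) ^ j := one_le_pow₀ (by linarith)
  have hX2 : (p : ℚ) ^ (2 * j) = (p : ℚ) ^ j * (p : ℚ) ^ j := by ring
  have hp1 : (0 : ℚ) < p - 1 := by linarith
  have h2 : (0 : ℚ) < p - 2 := by linarith
  have hzero : 0 ∈ lineCount Q v '' {g | g ≠ 0} := by
    rw [mem_image_lineCount_iff, hQ.directionCount_anisotropic_zero hp hv0, hX2]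
    apply ne_of_gt
    have : (0 : ℚ) < (p - 1) / 2 * ((p : ℚ) ^ (2 * j + 1) + (p : ℚ) ^ (j + 1)) := by positivity
    nlinarith
  have hone : 1 ∈ lineCount Q v '' {g | g ≠ 0} := by
    rw [mem_image_lineCount_iff, hQ.directionCount_anisotropic_one hp hv0, hX2]
    apply mul_ne_zero hp1.ne'
    apply ne_of_gt
    nlinarith
  have hcases : ∀ g, lineCount Q v g = 0 ∨ lineCount Q v g = 1 ∨ lineCount Q v g = 2 :=
    fun g => (lineCount_of_anisotropic hp hv0 g).1
  split_ifs with hj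
  · have htwo : 2 ∉ lineCount Q v '' {g | g ≠ 0} := by
      rw [mem_image_lineCount_iff, hQ.directionCount_anisotropic_two hp hv0, hj]
      simp
    have h : lineCount Q v '' {g | g ≠ 0} = (({0, 1} : Finset ℕ) : Set ℕ) := by
      ext t
      simp only [Finset.coe_insert, Finset.coe_singleton, Set.mem_insert_iff,
        Set.mem_singleton_iff]
      constructor
      · rintro ⟨g, hg, rfl⟩
        rcases hcases g with h | h | h
        · exact Or.inl h
        · exact Or.inr h
        · exact absurd ⟨g, hg, h⟩ htwo
      · rintro (rfl | rfl)
        exacts [hzero, hone]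
    rw [h, Set.ncard_coe_finset]
    rfl
  · have htwo : 2 ∈ lineCount Q v '' {g | g ≠ 0} := by
      rw [mem_image_lineCount_iff, hQ.directionCount_anisotropic_two hp hv0, hX2]
      have hX' : (1 : ℚ) < (p : ℚ) ^ j := one_lt_pow₀ (by linarith) hj
      have : (0 : ℚ) < (p : ℚ) ^ j * (p : ℚ) ^ j - (p : ℚ) ^ j := by nlinarith
      positivity
    have h : lineCount Q v '' {g | g ≠ 0} = (({0, 1, 2} : Finset ℕ) : Set ℕ) := by
      ext t
      simp only [Finset.coe_insert, Finset.coe_singleton, Set.mem_insert_iff,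
        Set.mem_singleton_iff]
      constructor
      · rintro ⟨g, hg, rfl⟩
        exact hcases g
      · rintro (rfl | rfl | rfl)
        exacts [hzero, hone, htwo]
    rw [h, Set.ncard_coe_finset]
    rfl

end NumberOfWeights

/-! ### The weight distribution -/

theorem theorem2 (p m : ℕ) [Fact p.Prime] (hp : p ≠ 2) (hm : m % 4 = 2)
    (F : Type*) [Field F] [Finite F] [Algebra (ZMod p) F] (hF : Nat.card F = p ^ m)
    -- `d` lists the elements of the defining set, each once, in an arbitrary order
    (n : ℕ) (d : Fin n → F) (hd : Function.Injective d) (hD : Set.range d = definingSet p F) :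
    -- the length; the division by 2 in the exponents is exact
    (p ∣ m → (n : ℚ) =
      (p : ℚ) ^ (m - 1) - 1 - ((p : ℚ) - 1) * (p : ℚ) ^ (((m : ℤ) - 1 + (-1) ^ (m / 2)) / 2)) ∧
    (¬ p ∣ m → (n : ℚ) =
      (p : ℚ) ^ (m - 1) - 1 + (p : ℚ) ^ (((m : ℤ) - 1 + (-1) ^ (m / 2)) / 2)) ∧
    -- the dimension
    Module.finrank (ZMod p) (traceCode p d) = m ∧
    -- the number of nonzero weights
    numNonzeroWeights (traceCode p d) ≤ 3 ∧
    (numNonzeroWeights (traceCode p d) = 2 ↔ m = 2) ∧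
    -- the weight distribution when `p ∣ m`
    (p ∣ m → ∀ w : ℕ, (weightCount (traceCode p d) w : ℚ) =
      if (w : ℚ) = 0 then 1
      else if (w : ℚ) = ((p : ℚ) - 1) * (p : ℚ) ^ (m - 2) then
        (p : ℚ) ^ (m - 2) - ((p : ℚ) - 1) * (p : ℚ) ^ (m / 2 - 1) - 1
      else if (w : ℚ) = ((p : ℚ) - 1) * ((p : ℚ) ^ (m - 2) - (p : ℚ) ^ (m / 2 - 1)) then
        ((p : ℚ) - 1) * (2 * (p : ℚ) ^ (m - 2) + (p : ℚ) ^ (m / 2 - 1))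
      else if (w : ℚ) =
          ((p : ℚ) - 1) * (p : ℚ) ^ (m - 2) - ((p : ℚ) - 2) * (p : ℚ) ^ (m / 2 - 1) then
        ((p : ℚ) - 1) ^ 2 * (p : ℚ) ^ (m - 2)
      else 0) ∧
    -- the weight distribution when `p ∤ m`
    (¬ p ∣ m → ∀ w : ℕ, (weightCount (traceCode p d) w : ℚ) =
      if (w : ℚ) = 0 then 1
      else if (w : ℚ) = ((p : ℚ) - 1) * (p : ℚ) ^ (m - 2) then
        (p : ℚ) ^ (m - 2) + ((p : ℚ) - 1) / 2 * ((p : ℚ) ^ (m - 1) + (p : ℚ) ^ (m / 2)) - 1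
      else if (w : ℚ) = ((p : ℚ) - 1) * (p : ℚ) ^ (m - 2) + (p : ℚ) ^ (m / 2 - 1) then
        ((p : ℚ) - 1) * (2 * (p : ℚ) ^ (m - 2) - (p : ℚ) ^ (m / 2 - 1))
      else if (w : ℚ) = ((p : ℚ) - 1) * (p : ℚ) ^ (m - 2) + 2 * (p : ℚ) ^ (m / 2 - 1) then
        ((p : ℚ) - 1) * ((p : ℚ) - 2) / 2 * ((p : ℚ) ^ (m - 2) - (p : ℚ) ^ (m / 2 - 1))
      else 0) := by
  classical
  have : Fintype F := Fintype.ofFinite F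
  obtain ⟨j, hj, rfl⟩ : ∃ j, Even j ∧ m = 2 * j + 2 :=
    ⟨m / 2 - 1, by rw [Nat.even_iff]; omega, by omega⟩
  have hp2 : (2 : ZMod p) ≠ 0 := Ring.two_ne_zero (by rwa [ZMod.ringChar_zmod_n])
  have hpq : (2 : ℚ) < p := by
    exact_mod_cast lt_of_le_of_ne (Fact.out : p.Prime).two_le hp.symm
  have hF' : Fintype.card F = p ^ (2 * j + 2) := by rw [← Nat.card_eq_fintype_card, hF]
  have hrank : Module.finrank (ZMod p) F = 2 * j + 2 := by
    have h := Module.card_eq_pow_finrank (K := ZMod p) (V := F)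
    rw [hF', ZMod.card] at h
    exact (Nat.pow_right_injective (Fact.out : p.Prime).two_le h).symm
  have hQ := isElliptic_traceNormForm (F := F) hp hj hF'
  obtain ⟨φ, hφ⟩ := exists_trace_dual (F := F) hQ.separatingLeft
  have hlen := length_eq hp2 hd hD hQ
  have hv0 := traceNormForm_squareCenter (F := F) hp2
  have hv := squareCenter_ne_zero (F := F) hp2
  have hwt := fun (g : F) hg => hammingNorm_traceWord_dual hp2 hd hD hQ hφ (g := g) hg
  rw [hrank] at hlen hv0
  set T := lineCount (traceNormForm p F) (squareCenter p F) with hTdef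
  have hX : (1 : ℚ) ≤ (p : ℚ) ^ j := one_le_pow₀ (by linarith)
  have hX2 : (p : ℚ) ^ (2 * j) = (p : ℚ) ^ j * (p : ℚ) ^ j := by ring
  have hX1 : (p : ℚ) ^ (2 * j + 1) = p * ((p : ℚ) ^ j * (p : ℚ) ^ j) := by ring
  -- `p ∣ 2 * j + 2` excludes `j = 0`, as `p` is odd, and `j` is even
  have hj2 : p ∣ 2 * j + 2 → 2 ≤ j := by
    intro h
    rcases Nat.lt_or_ge j 2 with h1 | h1
    · exfalso
      have h0 : j = 0 := by
        obtain ⟨r, rfl⟩ := hj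
        omega
      subst h0
      have := Nat.le_of_dvd (by norm_num) h
      have := (Fact.out : p.Prime).two_le
      omega
    · exact h1
  -- all weights of nonzero codewords are positive, hence encoding is injective
  have hpos : ∀ g ≠ 0, (0 : ℚ) < hammingNorm (traceWord p d (φ g)) := by
    intro g hg
    rw [hwt g hg]
    have hT0 : (0 : ℚ) ≤ (p : ℚ) ^ j * T g := by positivity
    split_ifs at hlen with h
    · have hXp : (p : ℚ) ^ 2 ≤ (p : ℚ) ^ j := pow_le_pow_right₀ (by linarith) (hj2 h)
      rw [hlen, hX2, hX1]
      have : (p : ℚ) ^ j * ((p - 1) * (p : ℚ) ^ j - p) > 0 := by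
        apply mul_pos (by linarith)
        nlinarith
      linarith
    · rw [hlen, hX2, hX1]
      have : (0 : ℚ) < (p - 1) * ((p : ℚ) ^ j * (p : ℚ) ^ j) := by
        have : (0 : ℚ) < p - 1 := by linarith
        positivity
      linarith
  have hker : Function.Injective (traceWord p d ∘ₗ φ.toLinearMap) := by
    rw [← LinearMap.ker_eq_bot, LinearMap.ker_eq_bot']
    intro g hg
    by_contra h
    have h1 := hpos g h
    have h2 : traceWord p d (φ g) = 0 := hg
    rw [h2] at h1
    simp at h1
  have hinj : Function.Injective fun g => traceWord p d (φ g) := hker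
  have hC : ∀ x, x ∈ traceCode p d ↔ x ∈ Set.range fun g => traceWord p d (φ g) := by
    intro x
    rw [traceCode_eq_range]
    constructor
    · rintro ⟨b, rfl⟩
      exact ⟨φ.symm b, by simp⟩
    · rintro ⟨g, rfl⟩
      exact ⟨φ g, rfl⟩
  have hc0 : traceWord p d (φ 0) = 0 := by simp
  have hβ : (p : ℚ) ^ j ≠ 0 := by positivity
  have hdim : Module.finrank (ZMod p) (traceCode p d) = 2 * j + 2 := by
    rw [traceCode_eq_range, LinearMap.finrank_range_of_inj, hrank]
    intro a b hab
    have := @hinj (φ.symm a) (φ.symm b) (by simpa using hab)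
    exact φ.symm.injective this
  have hnum := numNonzeroWeights_eq_ncard hinj hC hc0 hβ hwt
  have hnum3 : numNonzeroWeights (traceCode p d) = if j = 0 then 2 else 3 := by
    rw [hnum]
    by_cases h : p ∣ 2 * j + 2
    · have := hj2 h
      rw [hQ.ncard_lineCount_isotropic hp2 this hv (hv0.2 h), if_neg (by omega)]
    · exact hQ.ncard_lineCount_anisotropic hp2 (mt hv0.1 h)
  have hexp : (((2 * j + 2 : ℕ) : ℤ) - 1 + (-1) ^ ((2 * j + 2) / 2)) / 2 = (j : ℤ) := by
    have h1 : (2 * j + 2) / 2 = j + 1 := by omega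
    rw [h1, hj.add_one.neg_one_pow]
    push_cast
    omega
  have e1 : 2 * j + 2 - 1 = 2 * j + 1 := rfl
  have e2 : 2 * j + 2 - 2 = 2 * j := rfl
  have e3 : (2 * j + 2) / 2 - 1 = j := by omega
  have e4 : (2 * j + 2) / 2 = j + 1 := by omega
  rw [hexp, zpow_natCast, e1, e2, e3, e4]
  refine ⟨?_, ?_, hdim, ?_, ?_, ?_, ?_⟩
  · intro h
    rw [if_pos h] at hlen
    linear_combination hlen
  · intro h
    rw [if_neg h] at hlen
    linear_combination hlen
  · rw [hnum3]
    split_ifs <;> omega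
  · rw [hnum3]
    split_ifs <;> omega
  · intro h w
    rw [if_pos h] at hlen
    have hQv := hv0.2 h
    split_ifs with h0 h1 h2 h3
    · rw [Nat.cast_eq_zero.1 h0, weightCount_zero hinj hC hc0, Nat.cast_one]
    · have hw : w ≠ 0 := fun hw => h0 (by simp [hw])
      rw [weightCount_eq_of_affine (t := p) hinj hC hc0 hβ hwt hw
        (by rw [h1]; linear_combination -hlen)]
      exact hQ.directionCount_isotropic_max hp2 hv hQv
    · have hw : w ≠ 0 := fun hw => h0 (by simp [hw])
      rw [weightCount_eq_of_affine (t := 1) hinj hC hc0 hβ hwt hw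
        (by rw [h2]; push_cast; linear_combination -hlen)]
      exact hQ.directionCount_isotropic_one hp2 hv hQv
    · have hw : w ≠ 0 := fun hw => h0 (by simp [hw])
      rw [weightCount_eq_of_affine (t := 2) hinj hC hc0 hβ hwt hw
        (by rw [h3]; push_cast; linear_combination -hlen)]
      exact hQ.directionCount_isotropic_two hp2 hv hQv
    · have hw : w ≠ 0 := fun hw => h0 (by simp [hw])
      rw [weightCount_eq_zero_of_affine hinj hC hc0 hwt hw, Nat.cast_zero]
      intro g _ hg
      rw [hTdef, lineCount_of_isotropic hp2 hQv] at hg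
      split_ifs at hg
      · exact h1 (by rw [hg]; linear_combination hlen)
      · exact h3 (by rw [hg]; push_cast; linear_combination hlen)
      · exact h2 (by rw [hg]; push_cast; linear_combination hlen)
  · intro h w
    rw [if_neg h] at hlen
    have hQv := mt hv0.1 h
    split_ifs with h0 h1 h2 h3
    · rw [Nat.cast_eq_zero.1 h0, weightCount_zero hinj hC hc0, Nat.cast_one]
    · have hw : w ≠ 0 := fun hw => h0 (by simp [hw])
      rw [weightCount_eq_of_affine (t := 0) hinj hC hc0 hβ hwt hw
        (by rw [h1]; push_cast; linear_combination -hlen)]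
      exact hQ.directionCount_anisotropic_zero hp2 hQv
    · have hw : w ≠ 0 := fun hw => h0 (by simp [hw])
      rw [weightCount_eq_of_affine (t := 1) hinj hC hc0 hβ hwt hw
        (by rw [h2]; push_cast; linear_combination -hlen)]
      exact hQ.directionCount_anisotropic_one hp2 hQv
    · have hw : w ≠ 0 := fun hw => h0 (by simp [hw])
      rw [weightCount_eq_of_affine (t := 2) hinj hC hc0 hβ hwt hw
        (by rw [h3]; push_cast; linear_combination -hlen)]
      exact hQ.directionCount_anisotropic_two hp2 hQv
    · have hw : w ≠ 0 := fun hw => h0 (by simp [hw])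
      rw [weightCount_eq_zero_of_affine hinj hC hc0 hwt hw, Nat.cast_zero]
      intro g _ hg
      rcases (lineCount_of_anisotropic hp2 hQv g).1 with hT | hT | hT <;>
        rw [hTdef, hT] at hg
      · exact h1 (by rw [hg]; push_cast; linear_combination hlen)
      · exact h2 (by rw [hg]; push_cast; linear_combination hlen)
      · exact h3 (by rw [hg]; push_cast; linear_combination hlen)
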